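/- Let $q$ be an odd prime power. There is a function $g:\mathbb{N}\to\mathbb{R}$, depending only on $q$, with $g(m)=o(m)$ as $m\to\infty$, such that the following holds. Let $F\in\mathbb{F}_q[T]$ be irreducible of degree $r$, and let $m$ be a positive integer with $m\le r$. For $x\in\mathbb{F}_q[T]$ let $\deg_F x$ be the degree of the unique $x'$ with $\deg x'<r$ and $x'\equiv x \pmod F$ (where $\deg 0=-\infty$). Let $\alpha:\mathbb{F}_q[T]/\langle F\rangle\to\mathbb{C}$ be a weight supported on $\{x:\deg_F x<m\}$, and write $\alpha(x)$ also for its value at the class of a polynomial $x$. Put $\|\alpha\|_1=\sum_{x}|\alpha(x)|$ and $\|\alpha\|_\infty=\max_x|\alpha(x)|$, with $x$ running over $\mathbb{F}_q[T]/\langle F\rangle$, and $$E^{\mathrm{sqrt}}_{F,2}(\alpha)=\sum_{\substack{x_1,x_2,x_3,x_4\in\mathbb{F}_q[T],\ \deg x_i<r\\ x_1+x_2\equiv x_3+x_4\ (\mathrm{mod}\ F)}}\alpha(x_1^2)\,\overline{\alpha(x_2^2)}\,\alpha(x_3^2)\,\overline{\alpha(x_4^2)}.$$ Then $E^{\mathrm{sqrt}}_{F,2}(\alpha)$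 is a real number and $$E^{\mathrm{sqrt}}_{F,2}(\alpha)\le\|\alpha\|_1^{4/3}\,\|\alpha\|_\infty^{8/3}\,q^{m+g(m)}\left(q^{7m/6-r/2}+1\right).$$ -/

import Mathlib

open Polynomial Asymptotics Filter

universe u

noncomputable section

/-- `deg_F x`: the degree of the unique `x'` with `deg x' < deg F` and `x' ≡ x (mod F)`,
with the convention `deg 0 = -∞` (here `⊥`). -/
def degMod {K : Type u} [Field K] (F x : K[X]) : WithBot ℕ :=
  (x % F).degree

/-- There are finitely many polynomials of degree `< r` over a finite field. -/
theorem finite_degree_lt (K : Type u) [Field K] [Finite K] (r : ℕ) :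
    {x : K[X] | x.degree < r}.Finite := by
  have h : Finite (degreeLT K r) := Finite.of_equiv _ (degreeLTEquiv K r).toEquiv.symm
  refine (Set.toFinite (degreeLT K r : Set K[X])).subset ?_
  intro x hx
  exact mem_degreeLT.2 hx

/-- The set `I_r` of polynomials of degree `< r`. -/
def polyDegLT (K : Type u) [Field K] [Finite K] (r : ℕ) : Finset K[X] :=
  (finite_degree_lt K r).toFinset

/-- The value at a polynomial `x` of a weight on `K[T]/(F)`, through the quotient map. -/
def weightAt {K : Type u} [Field K] {F : K[X]} (α : (K[X] ⧸ Ideal.span {F}) → ℂ) (x : K[X]) : ℂ :=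
  α (Ideal.Quotient.mk (Ideal.span {F}) x)

/-- The additive energy of modular square roots
`∑ α(x₁²) conj(α(x₂²)) α(x₃²) conj(α(x₄²))`, over the `x₁, x₂, x₃, x₄` of degree `< deg F` with
`x₁ + x₂ ≡ x₃ + x₄ (mod F)`. It is a priori a complex number. -/
def sqrtEnergy {K : Type u} [Field K] [Finite K] (F : K[X])
    (α : (K[X] ⧸ Ideal.span {F}) → ℂ) : ℂ :=
  open Classical in
  ∑ x₁ ∈ polyDegLT K F.natDegree, ∑ x₂ ∈ polyDegLT K F.natDegree,
    ∑ x₃ ∈ polyDegLT K F.natDegree, ∑ x₄ ∈ polyDegLT K F.natDegree,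
      if F ∣ (x₁ + x₂) - (x₃ + x₄) then
        weightAt α (x₁ ^ 2) * (starRingEnd ℂ) (weightAt α (x₂ ^ 2)) *
          weightAt α (x₃ ^ 2) * (starRingEnd ℂ) (weightAt α (x₄ ^ 2))
      else 0

/-- The `ℓ₁` norm of a weight on a finite set. -/
def l1Norm {G : Type u} (α : G → ℂ) : ℝ := ∑ᶠ x, ‖α x‖

/-- The `ℓ_∞` norm of a weight on a finite non-empty set. -/
def lInftyNorm {G : Type u} (α : G → ℂ) : ℝ := ⨆ x, ‖α x‖

end

/-! Put β = |α|, M = ‖α‖_∞ and J(l) = ∑ β(x²)β((x+l)²) over the quotient ring. By the triangle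
inequality the energy is at most ∑ J(l)², so the question is how large J(l) is and how often.

Fix l ≠ 0. If u ≡ x² and v ≡ (x+l)² have degree < m, then (v-u)² ≡ l²(2(u+v) - l²). Subtracting this
relation for two such points removes l⁴ and leaves X ≡ l²Y with deg X < 2m and deg Y < m. Since X is
a difference of two squares, the divisor bound recovers the two points from (X, Y) up to a factor
q^{o(m)}. So the square of the number of x is controlled by a lattice point count
(`card_sqrtShift_sq_le`).

If a primitive lattice vector (b, c) leaves room h in the box, there are at most q^h + q^{3m-r}
lattice points (`card_boxLattice_le`). Hence, up to q^{o(m)}, either J(l) ≪ M²(1 + q^{(3m-r)/2}), or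
J(l) ≪ M² q^{h/2} and l² = b/c with b, c short. The second case holds for only O(q^{3m-2h}) values
of l, so it contributes about M⁸q^{3m} to the fourth moment. Interpolation with ∑ J(l) ≤ 4‖α‖₁²
yields ‖α‖₁^{4/3} M^{8/3} q^m. The first case yields M²‖α‖₁²(1 + q^{(3m-r)/2}), which takes the
required form through ‖α‖₁ ≤ q^m M. -/

theorem mem_polyDegLT {K : Type u} [Field K] [Finite K] {n : ℕ} {p : K[X]} :
    p ∈ polyDegLT K n ↔ p.degree < n := by
  simp [polyDegLT]

theorem card_polyDegLT (K : Type u) [Field K] [Finite K] (n : ℕ) :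
    (polyDegLT K n).card = Nat.card K ^ n := by
  have h1 : Nat.card (degreeLT K n) = Nat.card K ^ n := by
    rw [Nat.card_congr (degreeLTEquiv K n).toEquiv, Nat.card_fun, Nat.card_fin]
  have h2 : Nat.card (polyDegLT K n) = Nat.card (degreeLT K n) :=
    Nat.card_congr (Equiv.subtypeEquivRight fun p => by rw [mem_polyDegLT, mem_degreeLT])
  rw [← h1, ← h2]
  simp

/-! ### The divisor bound for polynomials over a finite field -/

section Divisors

open UniqueFactorizationMonoid

open Classical in
theorem natDegree_prod_normalizedFactors {K : Type u} [Field K] {d : K[X]} (hd : d ≠ 0) :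
    ((normalizedFactors d).map natDegree).sum = d.natDegree := by
  have h : ∀ p ∈ normalizedFactors d, p.Monic := fun p hp =>
    (normalize_normalized_factor p hp) ▸
      monic_normalize (irreducible_of_normalized_factor p hp).ne_zero
  have h0 : (0 : K[X]) ∉ normalizedFactors d := zero_notMem_normalizedFactors d
  rw [← natDegree_multiset_prod _ h0]
  exact natDegree_eq_of_degree_eq (degree_eq_degree_of_associated (prod_normalizedFactors hd))

open Classical in
theorem card_normalizedFactors_le {K : Type u} [Field K] {d : K[X]} (hd : d ≠ 0) :
    Multiset.card (normalizedFactors d) ≤ d.natDegree := by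
  rw [← natDegree_prod_normalizedFactors hd]
  have := Multiset.card_nsmul_le_sum (s := (normalizedFactors d).map natDegree) (a := 1) (by
    intro x hx
    obtain ⟨p, hp, rfl⟩ := Multiset.mem_map.1 hx
    exact (irreducible_of_normalized_factor p hp).natDegree_pos)
  simpa using this

open Classical in
theorem mul_card_filter_normalizedFactors_le {K : Type u} [Field K] {d : K[X]} (hd : d ≠ 0)
    (k : ℕ) :
    Multiset.card ((normalizedFactors d).filter fun p => ¬ p.degree < (k : WithBot ℕ)) * k ≤ d.natDegree := by
  rw [← natDegree_prod_normalizedFactors hd]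
  have := Multiset.card_nsmul_le_sum
    (s := ((normalizedFactors d).filter fun p => ¬ p.degree < (k : WithBot ℕ)).map natDegree) (a := k) (by
    intro x hx
    obtain ⟨p, hp, rfl⟩ := Multiset.mem_map.1 hx
    have := (Multiset.mem_filter.1 hp).2
    exact le_natDegree_of_coe_le_degree (not_lt.1 this))
  refine le_trans (by simpa only [Multiset.card_map, smul_eq_mul] using this) ?_
  conv_rhs => rw [← Multiset.filter_add_not (fun p : K[X] => p.degree < k) (normalizedFactors d)]
  rw [Multiset.map_add, Multiset.sum_add]
  exact Nat.le_add_left _ _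

open Classical in
-- A divisor is recovered from its leading coefficient, the multiplicities of its factors of degree
-- < k (at most q^k of them), and the submultiset of the large factors of `x`, of which there are at
-- most n/k.
theorem card_divisors_le {K : Type u} [Field K] [Finite K] {n k : ℕ} (hk : 0 < k) {x : K[X]}
    (hx : x ≠ 0) (hxn : x.degree < n) :
    ((polyDegLT K n).filter (· ∣ x)).card ≤
      Nat.card K * 2 ^ (n / k) * (n + 1) ^ (Nat.card K ^ k) := by
  have := Fintype.ofFinite K
  have hxn' : x.natDegree < n := (natDegree_lt_iff_degree_lt hx).2 hxn
  let big : K[X] → Multiset K[X] := fun d =>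
    (normalizedFactors d).filter fun p => ¬ p.degree < (k : WithBot ℕ)
  let T : Finset (K × (polyDegLT K k → ℕ) × Multiset K[X]) :=
    Finset.univ ×ˢ (Fintype.piFinset fun _ => Finset.range (n + 1)) ×ˢ
      (Multiset.powerset (big x)).toFinset
  let f : K[X] → K × (polyDegLT K k → ℕ) × Multiset K[X] := fun d =>
    (d.leadingCoeff, fun p => (normalizedFactors d).count p.1, big d)
  have hT : T.card ≤ Nat.card K * 2 ^ (n / k) * (n + 1) ^ (Nat.card K ^ k) := by
    have h1 : (Multiset.powerset (big x)).toFinset.card ≤ 2 ^ (n / k) := by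
      refine (Multiset.toFinset_card_le _).trans ?_
      rw [Multiset.card_powerset]
      refine Nat.pow_le_pow_right two_pos ?_
      rw [Nat.le_div_iff_mul_le hk]
      exact (mul_card_filter_normalizedFactors_le hx k).trans hxn'.le
    simp only [T, Finset.card_product, Fintype.card_piFinset, Finset.card_range,
      Finset.prod_const, Finset.card_univ, Fintype.card_coe, card_polyDegLT, Nat.card_eq_fintype_card]
    rw [mul_assoc]
    refine Nat.mul_le_mul_left _ ?_
    rw [mul_comm]
    exact Nat.mul_le_mul_right _ h1
  refine le_trans (Finset.card_le_card_of_injOn f ?_ ?_) hT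
  · intro d hd
    obtain ⟨hdn, hdx⟩ := Finset.mem_filter.1 hd
    have hd0 : d ≠ 0 := ne_zero_of_dvd_ne_zero hx hdx
    have hle := (dvd_iff_normalizedFactors_le_normalizedFactors hd0 hx).1 hdx
    simp only [T, f, Finset.coe_product, Set.mem_prod, Finset.mem_coe, Finset.mem_univ, true_and,
      Fintype.mem_piFinset, Finset.mem_range, Multiset.mem_toFinset, Multiset.mem_powerset]
    refine ⟨fun p => ?_, Multiset.filter_le_filter _ hle⟩
    have := (Multiset.count_le_card p.1 (normalizedFactors d)).trans (card_normalizedFactors_le hd0)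
    have := natDegree_le_of_dvd hdx hx
    omega
  · intro d hd e he hde
    simp only [f, Prod.mk.injEq] at hde
    obtain ⟨h1, h2, h3⟩ := hde
    have hd0 : d ≠ 0 := ne_zero_of_dvd_ne_zero hx (Finset.mem_filter.1 hd).2
    have he0 : e ≠ 0 := ne_zero_of_dvd_ne_zero hx (Finset.mem_filter.1 he).2
    have h : normalizedFactors d = normalizedFactors e := by
      ext p
      by_cases hp : p.degree < k
      · exact congrFun h2 ⟨p, mem_polyDegLT.2 hp⟩
      · have := congrArg (Multiset.count p) h3
        simpa [big, Multiset.count_filter, not_lt.1 hp] using this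
    rw [← leadingCoeff_mul_prod_normalizedFactors d, ← leadingCoeff_mul_prod_normalizedFactors e,
      h1, h]

end Divisors

/-- An upper bound for the number of divisors of a nonzero polynomial of degree `< n` over a field
with `q` elements. -/
noncomputable def divisorBound (q n : ℕ) : ℕ :=
  ⨅ k : ℕ, q * 2 ^ (n / (k + 1)) * (n + 1) ^ (q ^ (k + 1))

open Classical in
theorem card_divisors_le_divisorBound {K : Type u} [Field K] [Finite K] {n : ℕ} {x : K[X]}
    (hx : x ≠ 0) (hxn : x.degree < n) :
    ((polyDegLT K n).filter (· ∣ x)).card ≤ divisorBound (Nat.card K) n :=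
  le_ciInf fun k => card_divisors_le k.succ_pos hx hxn

theorem one_le_divisorBound {q : ℕ} (hq : 0 < q) (n : ℕ) : 1 ≤ divisorBound q n :=
  le_ciInf fun k => Nat.succ_le_of_lt (by positivity)

theorem log_divisorBound_le {q : ℕ} (hq : 0 < q) (n k : ℕ) :
    Real.log (divisorBound q n) ≤
      Real.log q + n / (k + 1) * Real.log 2 + (q : ℝ) ^ (k + 1) * Real.log (n + 1) := by
  have h1 : divisorBound q n ≤ q * 2 ^ (n / (k + 1)) * (n + 1) ^ (q ^ (k + 1)) :=
    ciInf_le (OrderBot.bddBelow _) k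
  have h2 : (divisorBound q n : ℝ) ≤ q * 2 ^ (n / (k + 1)) * (n + 1) ^ (q ^ (k + 1)) := by
    exact_mod_cast h1
  have h3 : (0 : ℝ) < divisorBound q n := by exact_mod_cast one_le_divisorBound hq n
  have hq' : (q : ℝ) ≠ 0 := by positivity
  refine (Real.log_le_log h3 h2).trans ?_
  rw [Real.log_mul (by positivity) (by positivity), Real.log_mul hq' (by positivity),
    Real.log_pow, Real.log_pow]
  push_cast
  gcongr
  have := Nat.cast_div_le (α := ℝ) (m := n) (n := k + 1)
  simpa using this

theorem isLittleO_log_divisorBound {q : ℕ} (hq : 0 < q) :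
    (fun n : ℕ => Real.log (divisorBound q n)) =o[atTop] (fun n : ℕ => (n : ℝ)) := by
  have hlog : ∀ C D : ℝ, (fun n : ℕ => C + D * Real.log (n + 1)) =o[atTop]
      (fun n : ℕ => (n : ℝ)) := by
    intro C D
    have h1 : (fun n : ℕ => C) =o[atTop] (fun n : ℕ => (n : ℝ)) :=
      isLittleO_const_left.2 (Or.inr (tendsto_norm_atTop_atTop.comp tendsto_natCast_atTop_atTop))
    have ht : Tendsto (fun n : ℕ => (n : ℝ) + 1) atTop atTop :=
      tendsto_atTop_add_const_right _ _ tendsto_natCast_atTop_atTop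
    have h2 : (fun n : ℕ => Real.log ((n : ℝ) + 1)) =o[atTop] (fun n : ℕ => (n : ℝ) + 1) :=
      Real.isLittleO_log_id_atTop.comp_tendsto ht
    have h3 : (fun n : ℕ => (n : ℝ) + 1) =O[atTop] (fun n : ℕ => (n : ℝ)) :=
      (isBigO_refl _ _).add (isLittleO_const_left.2
        (Or.inr (tendsto_norm_atTop_atTop.comp tendsto_natCast_atTop_atTop))).isBigO
    exact h1.add ((h2.trans_isBigO h3).const_mul_left D)
  rw [isLittleO_iff]
  intro ε hε
  -- For this fixed k the term n log 2/(k+1) is at most εn/2, and the remaining terms are O(log n).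
  obtain ⟨k, hk⟩ := exists_nat_gt (2 * Real.log 2 / ε)
  filter_upwards [isLittleO_iff.1 (hlog (Real.log q) ((q : ℝ) ^ (k + 1))) (half_pos hε)] with n hn
  have h0 : 0 ≤ Real.log (divisorBound q n) :=
    Real.log_nonneg (by exact_mod_cast one_le_divisorBound hq n)
  rw [Real.norm_of_nonneg h0, Real.norm_of_nonneg n.cast_nonneg]
  rw [Real.norm_of_nonneg n.cast_nonneg] at hn
  have h1 := log_divisorBound_le hq n k
  have h2 := (le_abs_self _).trans hn
  have h3 : (n : ℝ) / (k + 1) * Real.log 2 ≤ ε / 2 * n := by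
    rw [div_lt_iff₀ hε] at hk
    rw [div_mul_eq_mul_div, div_le_iff₀ (by positivity)]
    nlinarith [n.cast_nonneg (α := ℝ), mul_nonneg n.cast_nonneg hε.le]
  linarith

/-! ### Lattice points of X ≡ aY in a box, and pairs of small squares -/

section Lattice

variable {K : Type u} [Field K]

theorem natDegree_mul_lt_of_degree_lt {p s : K[X]} {n : ℕ} {k : ℕ}
    (hs : s.degree < k) (hp : p.natDegree + k ≤ n) : (p * s).degree < n := by
  rw [degree_mul]
  by_cases hp0 : p = 0
  · subst hp0; simp
  · rw [degree_eq_natDegree hp0]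
    by_cases hs0 : s = 0
    · subst hs0; simp
    · rw [degree_eq_natDegree hs0] at hs ⊢
      norm_cast at hs ⊢
      omega

theorem degree_lt_of_mul_degree_lt {p s : K[X]} {n k : ℕ} (hp0 : p ≠ 0)
    (hs : (p * s).degree < n) (hp : n ≤ p.natDegree + k) : s.degree < k := by
  by_cases hs0 : s = 0
  · subst hs0; simp
  · rw [degree_mul, degree_eq_natDegree hp0, degree_eq_natDegree hs0] at hs
    rw [degree_eq_natDegree hs0]
    norm_cast at hs ⊢
    omega

variable [Finite K] {R : Type u} [CommRing R]

open Classical in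
/-- The pairs `(X, Y)` with `deg X < 2 * m`, `deg Y < m` and `φ X = a * φ Y`. -/
noncomputable def boxLattice (φ : K[X] →+* R) (m : ℕ) (a : R) : Finset (K[X] × K[X]) :=
  (polyDegLT K (2 * m) ×ˢ polyDegLT K m).filter fun u => φ u.1 = a * φ u.2

theorem mem_boxLattice {φ : K[X] →+* R} {m : ℕ} {a : R} {u : K[X] × K[X]} :
    u ∈ boxLattice φ m a ↔
      (u.1.degree < (2 * m : ℕ) ∧ u.2.degree < m) ∧ φ u.1 = a * φ u.2 := by
  simp [boxLattice, mem_polyDegLT]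

open Classical in
-- By coprimality, two points with the same determinant against (b, c) differ by t(b, c). The
-- coordinate in which (b, c) fills the box up to h forces deg t < h.
theorem card_filter_det_le {φ : K[X] →+* R} {m h : ℕ} {a : R} {b c : K[X]}
    (hc : c ≠ 0) (hbc : IsCoprime b c)
    (hh : 2 * m ≤ b.natDegree + h ∧ b ≠ 0 ∨ m ≤ c.natDegree + h) (δ : K[X]) :
    ((boxLattice φ m a).filter fun u => b * u.2 - c * u.1 = δ).card ≤ Nat.card K ^ h := by
  rcases Finset.eq_empty_or_nonempty
    ((boxLattice φ m a).filter fun u => b * u.2 - c * u.1 = δ) with he | ⟨u₀, hu₀⟩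
  · simp [he]
  have key : ∀ u ∈ (boxLattice φ m a).filter fun u => b * u.2 - c * u.1 = δ,
      ∃ t : K[X], t.degree < h ∧ u = (u₀.1 + b * t, u₀.2 + c * t) := by
    intro u hu
    rw [Finset.mem_filter, mem_boxLattice] at hu hu₀
    have h1 : b * (u.2 - u₀.2) = c * (u.1 - u₀.1) := by linear_combination hu.2 - hu₀.2
    obtain ⟨t, ht⟩ : c ∣ u.2 - u₀.2 := hbc.symm.dvd_of_dvd_mul_left ⟨_, h1⟩
    have ht' : u.1 - u₀.1 = b * t := by
      apply mul_left_cancel₀ hc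
      rw [← h1, ht]; ring
    refine ⟨t, ?_, Prod.ext ?_ ?_⟩
    · rcases hh with ⟨hh, hb⟩ | hh
      · refine degree_lt_of_mul_degree_lt hb ?_ hh
        rw [← ht']
        exact (degree_sub_le _ _).trans_lt (max_lt hu.1.1.1 hu₀.1.1.1)
      · refine degree_lt_of_mul_degree_lt hc ?_ hh
        rw [← ht]
        exact (degree_sub_le _ _).trans_lt (max_lt hu.1.1.2 hu₀.1.1.2)
    · linear_combination ht'
    · linear_combination ht
  choose! t ht htu using key
  rw [← card_polyDegLT]
  refine Finset.card_le_card_of_injOn t (fun u hu => mem_polyDegLT.2 (ht u hu)) ?_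
  intro u hu v hv huv
  rw [htu u hu, htu v hv, huv]

open Classical in
theorem card_polyDegLT_dvd_le {F : K[X]} (hF : F ≠ 0) (n : ℕ) :
    ((polyDegLT K n).filter (F ∣ ·)).card ≤ Nat.card K ^ (n - F.natDegree) := by
  rw [← card_polyDegLT]
  refine Finset.card_le_card_of_injOn (· / F) ?_ ?_
  · intro p hp
    obtain ⟨hp, s, rfl⟩ := Finset.mem_filter.1 hp
    simp only [mul_div_cancel_left₀ _ hF]
    exact mem_polyDegLT.2 (degree_lt_of_mul_degree_lt hF (mem_polyDegLT.1 hp) (by omega))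
  · intro p hp p' hp' h
    obtain ⟨-, s, rfl⟩ := Finset.mem_filter.1 hp
    obtain ⟨-, s', rfl⟩ := Finset.mem_filter.1 hp'
    simp only [mul_div_cancel_left₀ _ hF] at h
    rw [h]

/-- The determinant bY - cX of two lattice vectors is divisible by F and has degree < 3m - h. When
3m - h ≤ deg F only the value 0 survives, which the truncated subtraction counts as 1. -/
theorem card_boxLattice_le {φ : K[X] →+* R} {F : K[X]} (hF : F ≠ 0)
    (hφ : ∀ p, φ p = 0 ↔ F ∣ p) {m h : ℕ} {a : R} {b c : K[X]} (hc : c ≠ 0)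
    (hbc : IsCoprime b c) (hbcL : φ b = a * φ c) (hbh : b.natDegree + h ≤ 2 * m)
    (hch : c.natDegree + h ≤ m)
    (hh : 2 * m ≤ b.natDegree + h ∧ b ≠ 0 ∨ m ≤ c.natDegree + h) :
    (boxLattice φ m a).card ≤ Nat.card K ^ h * Nat.card K ^ (3 * m - h - F.natDegree) := by
  classical
  refine (Finset.card_le_mul_card_image (f := fun u : K[X] × K[X] => b * u.2 - c * u.1) (boxLattice φ m a) (Nat.card K ^ h)
    fun δ _ => card_filter_det_le hc hbc hh δ).trans ?_
  refine Nat.mul_le_mul_left _ (le_trans (Finset.card_le_card ?_) (card_polyDegLT_dvd_le hF _))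
  intro δ hδ
  obtain ⟨u, hu, rfl⟩ := Finset.mem_image.1 hδ
  obtain ⟨⟨h1, h2⟩, h3⟩ := mem_boxLattice.1 hu
  refine Finset.mem_filter.2 ⟨mem_polyDegLT.2 ?_, (hφ _).1 ?_⟩
  · refine (degree_sub_le _ _).trans_lt (max_lt ?_ ?_)
    · exact natDegree_mul_lt_of_degree_lt h2 (by omega)
    · exact natDegree_mul_lt_of_degree_lt h1 (by omega)
  · simp only [map_sub, map_mul, h3, hbcL]
    ring

variable [IsDomain R]

theorem exists_primitive_of_mem_boxLattice {φ : K[X] →+* R} {F : K[X]}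
    (hφ : ∀ p, φ p = 0 ↔ F ∣ p) {m : ℕ} (hm : m ≤ F.natDegree) {a : R} {X Y : K[X]}
    (hXY : (X, Y) ∈ boxLattice φ m a) (hY : Y ≠ 0) :
    ∃ b c : K[X], (b, c) ∈ boxLattice φ m a ∧ c ≠ 0 ∧ IsCoprime b c := by
  obtain ⟨⟨h1, h2⟩, h3⟩ := mem_boxLattice.1 hXY
  simp only at h1 h2 h3
  obtain ⟨g, b, c, hbc, hX, hY'⟩ : ∃ g b c : K[X], IsCoprime b c ∧ X = g * b ∧ Y = g * c := by
    classical
    obtain ⟨b, hb⟩ := EuclideanDomain.gcd_dvd_left X Y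
    obtain ⟨c, hc⟩ := EuclideanDomain.gcd_dvd_right X Y
    have hg : EuclideanDomain.gcd X Y ≠ 0 := by
      intro h
      exact hY (EuclideanDomain.gcd_eq_zero_iff.1 h).2
    refine ⟨EuclideanDomain.gcd X Y, b, c, ?_, hb, hc⟩
    have hbez := EuclideanDomain.gcd_eq_gcd_ab X Y
    refine ⟨EuclideanDomain.gcdA X Y, EuclideanDomain.gcdB X Y, ?_⟩
    apply mul_left_cancel₀ hg
    conv_rhs => rw [mul_one, hbez]
    conv_rhs =>
      rw [show X * EuclideanDomain.gcdA X Y + Y * EuclideanDomain.gcdB X Y =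
        (EuclideanDomain.gcd X Y * b) * EuclideanDomain.gcdA X Y +
        (EuclideanDomain.gcd X Y * c) * EuclideanDomain.gcdB X Y by rw [← hb, ← hc]]
    ring
  subst hX
  subst hY'
  have hg0 : g ≠ 0 := left_ne_zero_of_mul hY
  have hc0 : c ≠ 0 := right_ne_zero_of_mul hY
  -- The gcd may be cancelled modulo F because its degree is at most deg Y < m ≤ deg F.
  have hφg : φ g ≠ 0 := by
    intro h
    have h4 := natDegree_le_of_dvd ((hφ _).1 h) hg0
    rw [← natDegree_lt_iff_degree_lt hY, natDegree_mul hg0 hc0] at h2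
    omega
  refine ⟨b, c, mem_boxLattice.2 ⟨⟨?_, ?_⟩, ?_⟩, hc0, hbc⟩
  · exact degree_lt_of_mul_degree_lt hg0 h1 (Nat.le_add_left _ _)
  · exact degree_lt_of_mul_degree_lt hg0 h2 (Nat.le_add_left _ _)
  · apply mul_left_cancel₀ hφg
    simp only [map_mul] at h3
    simp only [h3]
    ring

/-- The elements whose square is a quotient `φ b / φ c` with `deg b ≤ 2 * m - h` and
`deg c ≤ m - h`. -/
def IsShortSqrt (φ : K[X] →+* R) (m h : ℕ) (l : R) : Prop :=
  ∃ b c : K[X], φ c ≠ 0 ∧ φ b = l ^ 2 * φ c ∧ b.degree < (2 * m - h + 1 : ℕ) ∧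
    c.degree < (m - h + 1 : ℕ)

open Classical in
-- Each pair (b, c) admits at most two l, and the two degree bounds add up to 3m - 2h + 2 free
-- coefficients.
theorem card_isShortSqrt_le [Fintype R] (φ : K[X] →+* R) {m h : ℕ} (hh : h ≤ m) :
    (Finset.univ.filter (IsShortSqrt φ m h)).card * Nat.card K ^ (2 * h) ≤
      2 * Nat.card K ^ (3 * m + 2) := by
  have h1 : (Finset.univ.filter (IsShortSqrt φ m h)) ⊆
      (polyDegLT K (2 * m - h + 1) ×ˢ polyDegLT K (m - h + 1)).biUnion fun u =>
        Finset.univ.filter fun l : R => φ u.2 ≠ 0 ∧ φ u.1 = l ^ 2 * φ u.2 := by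
    intro l hl
    obtain ⟨b, c, hc, hbc, hb, hc'⟩ := (Finset.mem_filter.1 hl).2
    refine Finset.mem_biUnion.2 ⟨(b, c), ?_, ?_⟩
    · exact Finset.mem_product.2 ⟨mem_polyDegLT.2 hb, mem_polyDegLT.2 hc'⟩
    · simp [hc, hbc]
  have h2 : (Finset.univ.filter (IsShortSqrt φ m h)).card ≤
      Nat.card K ^ (2 * m - h + 1) * Nat.card K ^ (m - h + 1) * 2 := by
    refine (Finset.card_le_card h1).trans (Finset.card_biUnion_le_card_mul _ _ 2 ?_ |>.trans ?_)
    · rintro u -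
      by_contra! hlt
      obtain ⟨l, hl⟩ := Finset.card_pos.1 (pos_of_gt hlt)
      have hsub : (Finset.univ.filter fun l : R => φ u.2 ≠ 0 ∧ φ u.1 = l ^ 2 * φ u.2) ⊆
          {l, -l} := by
        intro l' hl'
        obtain ⟨-, hu, hl⟩ := Finset.mem_filter.1 hl
        obtain ⟨-, -, hl'⟩ := Finset.mem_filter.1 hl'
        have : l' ^ 2 = l ^ 2 := mul_right_cancel₀ hu (hl'.symm.trans hl)
        simpa using sq_eq_sq_iff_eq_or_eq_neg.1 this
      have := (Finset.card_le_card hsub).trans Finset.card_le_two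
      omega
    · rw [Finset.card_product, card_polyDegLT, card_polyDegLT]
  calc _ ≤ (Nat.card K ^ (2 * m - h + 1) * Nat.card K ^ (m - h + 1) * 2) * Nat.card K ^ (2 * h) :=
        Nat.mul_le_mul_right _ h2
    _ = 2 * Nat.card K ^ ((2 * m - h + 1) + (m - h + 1) + 2 * h) := by ring
    _ = _ := by congr 2; omega

/-- The `x` such that `x ^ 2` and `(x + l) ^ 2` are both images of polynomials of degree `< m`. -/
def sqrtShift (φ : K[X] →+* R) (m : ℕ) (l : R) : Set R :=
  {x | x ^ 2 ∈ φ '' {p | p.degree < m} ∧ (x + l) ^ 2 ∈ φ '' {p | p.degree < m}}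

open Classical in
theorem card_sqrtShift_sq_le [Fintype R] {φ : K[X] →+* R} {F : K[X]}
    (hφ : ∀ p, φ p = 0 ↔ F ∣ p) {m : ℕ} (hm : m ≤ F.natDegree) (h2K : (2 : K) ≠ 0)
    (h2 : (2 : R) ≠ 0) {l : R} (hl : l ≠ 0) :
    (Finset.univ.filter (· ∈ sqrtShift φ m l)).card ^ 2 ≤
      2 * (Finset.univ.filter (· ∈ sqrtShift φ m l)).card +
        divisorBound (Nat.card K) (2 * m) *
          ((boxLattice φ m (l ^ 2)).filter fun u => u.2 ≠ 0).card := by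
  set S := Finset.univ.filter (· ∈ sqrtShift φ m l)
  have hS : ∀ x ∈ S, ∃ u v : K[X], u.degree < m ∧ v.degree < m ∧ φ u = x ^ 2 ∧
      φ v = (x + l) ^ 2 := by
    intro x hx
    obtain ⟨⟨u, hu, hux⟩, v, hv, hvx⟩ := (Finset.mem_filter.1 hx).2
    exact ⟨u, v, hu, hv, hux, hvx⟩
  choose! u v hu hv hux hvx using hS
  -- With w = v - u = 2xl + l² one has w² = l²(2(u+v) - l²) in the quotient; the difference over two
  -- points is free of l⁴.
  let G : R × R → K[X] × K[X] := fun p =>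
    ((v p.1 - u p.1) ^ 2 - (v p.2 - u p.2) ^ 2, 2 * ((u p.1 + v p.1) - (u p.2 + v p.2)))
  have h2X : (2 : K[X]) = C 2 := rfl
  have hw : ∀ x ∈ S, (v x - u x).degree < m := fun x hx =>
    (degree_sub_le _ _).trans_lt (max_lt (hv x hx) (hu x hx))
  have hsq : ∀ p : K[X], p.degree < m → (p ^ 2).degree < (2 * m : ℕ) := by
    intro p hp
    rw [sq]
    by_cases hp0 : p = 0
    · subst hp0; rw [mul_zero, degree_zero]; exact WithBot.bot_lt_coe _
    · rw [← natDegree_lt_iff_degree_lt hp0] at hp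
      refine natDegree_mul_lt_of_degree_lt (k := m) (degree_lt_of_mul_degree_lt (k := m)
        (one_ne_zero (α := K[X])) (n := m) ?_ (by omega)) (by omega)
      rw [one_mul, ← natDegree_lt_iff_degree_lt hp0]
      exact hp
  have hG : ∀ p ∈ S ×ˢ S, G p ∈ boxLattice φ m (l ^ 2) := by
    intro p hp
    obtain ⟨hp1, hp2⟩ := Finset.mem_product.1 hp
    refine mem_boxLattice.2 ⟨⟨?_, ?_⟩, ?_⟩
    · exact (degree_sub_le _ _).trans_lt (max_lt (hsq _ (hw _ hp1)) (hsq _ (hw _ hp2)))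
    · simp only [G, h2X]
      rw [degree_C_mul h2K]
      refine (degree_sub_le _ _).trans_lt (max_lt ?_ ?_)
      · exact (degree_add_le _ _).trans_lt (max_lt (hu _ hp1) (hv _ hp1))
      · exact (degree_add_le _ _).trans_lt (max_lt (hu _ hp2) (hv _ hp2))
    · simp only [G, map_sub, map_mul, map_pow, map_add, map_ofNat, hux _ hp1, hux _ hp2,
        hvx _ hp1, hvx _ hp2]
      ring
  -- Y = 0 forces 4l²(x - y)(x + y + l) = 0, so y = x or y = -x - l.
  have hzero : ((S ×ˢ S).filter fun p => (G p).2 = 0).card ≤ S.card * 2 := by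
    refine Finset.card_le_mul_card_image_of_maps_to (f := Prod.fst) (t := S) ?_ 2 ?_ |>.trans
      (by rw [mul_comm])
    · intro p hp
      exact (Finset.mem_product.1 (Finset.mem_filter.1 hp).1).1
    · intro x hx
      have hsub : (((S ×ˢ S).filter fun p => (G p).2 = 0).filter fun p => p.1 = x) ⊆
          {(x, x), (x, -x - l)} := by
        rintro ⟨x', y⟩ hp
        simp only [Finset.mem_filter, Finset.mem_product] at hp
        obtain ⟨⟨⟨hx', hy⟩, h0⟩, rfl⟩ := hp
        have h4 := (mem_boxLattice.1 (hG (x', y) (Finset.mem_product.2 ⟨hx', hy⟩))).2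
        rw [h0, map_zero, mul_zero] at h4
        simp only [G, map_sub, map_pow, hux _ hx', hux _ hy, hvx _ hx', hvx _ hy] at h4
        have h5 : 2 * 2 * l ^ 2 * ((x' - y) * (y - (-x' - l))) = 0 := by
          linear_combination h4
        have h6 : (x' - y) * (y - (-x' - l)) = 0 :=
          (mul_eq_zero.1 h5).resolve_left (mul_ne_zero (mul_ne_zero h2 h2) (pow_ne_zero _ hl))
        rcases mul_eq_zero.1 h6 with h | h
        · simp [(sub_eq_zero.1 h)]
        · simp [(sub_eq_zero.1 h)]
      exact (Finset.card_le_card hsub).trans Finset.card_le_two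
  have hnz : ((S ×ˢ S).filter fun p => ¬ (G p).2 = 0).card ≤
      divisorBound (Nat.card K) (2 * m) *
        ((boxLattice φ m (l ^ 2)).filter fun u => u.2 ≠ 0).card := by
    refine Finset.card_le_mul_card_image_of_maps_to (f := G) ?_ _ ?_
    · intro p hp
      obtain ⟨hp, h0⟩ := Finset.mem_filter.1 hp
      exact Finset.mem_filter.2 ⟨hG p hp, h0⟩
    · intro Z hZ
      obtain ⟨hZ, hZ0⟩ := Finset.mem_filter.1 hZ
      obtain ⟨⟨hZ1, hZ2⟩, hZφ⟩ := mem_boxLattice.1 hZ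
      have hZ10 : Z.1 ≠ 0 := by
        intro h
        rw [h, map_zero, eq_comm, mul_eq_zero] at hZφ
        have h3 := (hφ _).1 (hZφ.resolve_left (pow_ne_zero _ hl))
        have h4 := natDegree_le_of_dvd h3 hZ0
        rw [← natDegree_lt_iff_degree_lt hZ0] at hZ2
        omega
      refine le_trans ?_ (card_divisors_le_divisorBound hZ10 hZ1)
      -- The difference of the two values w divides X. Together with X ≠ 0 it fixes their sum, hence
      -- both w, hence both points, as 4l is invertible enough to cancel.
      refine Finset.card_le_card_of_injOn
        (fun p => (v p.1 - u p.1) - (v p.2 - u p.2)) ?_ ?_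
      · intro p hp
        simp only [Finset.mem_coe, Finset.mem_filter,
          Finset.mem_product] at hp
        obtain ⟨⟨⟨hp1, hp2⟩, -⟩, rfl⟩ := hp
        refine Finset.mem_filter.2 ⟨mem_polyDegLT.2 ?_, ⟨(v p.1 - u p.1) + (v p.2 - u p.2), ?_⟩⟩
        · refine (degree_sub_le _ _).trans_lt (max_lt ?_ ?_)
          · exact (hw _ hp1).trans_le (by exact_mod_cast (by omega : m ≤ 2 * m))
          · exact (hw _ hp2).trans_le (by exact_mod_cast (by omega : m ≤ 2 * m))
        · simp only [G]; ring
      · rintro ⟨x, y⟩ hp ⟨x', y'⟩ hp' hd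
        simp only [Finset.mem_coe, Finset.mem_filter,
          Finset.mem_product] at hp hp'
        obtain ⟨⟨⟨hx, hy⟩, -⟩, rfl⟩ := hp
        obtain ⟨⟨⟨hx', hy'⟩, -⟩, hGG⟩ := hp'
        simp only at hd
        have hZne : (v x - u x) - (v y - u y) ≠ 0 := by
          intro h
          apply hZ10
          simp only [G]
          linear_combination ((v x - u x) + (v y - u y)) * h
        have h3 : (v x' - u x') ^ 2 - (v y' - u y') ^ 2 = (v x - u x) ^ 2 - (v y - u y) ^ 2 :=
          congrArg Prod.fst hGG
        have h4 : (v x' - u x') + (v y' - u y') = (v x - u x) + (v y - u y) := by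
          apply mul_left_cancel₀ hZne
          linear_combination h3 + ((v x' - u x') + (v y' - u y')) * hd
        have h5 := congrArg φ hd
        have h6 := congrArg φ h4
        simp only [map_sub, map_add, hux _ hx, hux _ hy, hvx _ hx, hvx _ hy, hux _ hx',
          hux _ hy', hvx _ hx', hvx _ hy'] at h5 h6
        have h4l : 2 * 2 * l ≠ 0 := mul_ne_zero (mul_ne_zero h2 h2) hl
        refine Prod.ext (mul_left_cancel₀ h4l ?_) (mul_left_cancel₀ h4l ?_)
        · linear_combination h5 - h6
        · linear_combination -h5 - h6
  rw [sq, ← Finset.card_product, ← Finset.card_filter_add_card_filter_not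
    (s := S ×ˢ S) (fun p => (G p).2 = 0)]
  omega

end Lattice

/-! ### Moments of the shift weights -/

section Energy

variable {R : Type u} [CommRing R] [Fintype R]

/-- The weighted number of `x` such that `x ^ 2` and `(x + l) ^ 2` are counted by `β`. -/
def shiftWeight (β : R → ℝ) (l : R) : ℝ := ∑ x, β (x ^ 2) * β ((x + l) ^ 2)

theorem shiftWeight_nonneg {β : R → ℝ} (hβ : ∀ x, 0 ≤ β x) (l : R) : 0 ≤ shiftWeight β l :=
  Finset.sum_nonneg fun _ _ => mul_nonneg (hβ _) (hβ _)

theorem sum_shiftWeight (β : R → ℝ) : ∑ l, shiftWeight β l = (∑ x, β (x ^ 2)) ^ 2 := by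
  unfold shiftWeight
  rw [Finset.sum_comm, sq, Finset.sum_mul_sum]
  refine Finset.sum_congr rfl fun x _ => ?_
  exact Equiv.sum_comp (Equiv.addLeft x) fun y => β (x ^ 2) * β (y ^ 2)

open Classical in
-- Group the solutions by l = x₃ - x₁ = x₂ - x₄.
theorem sum_energy_eq_sum_shiftWeight_sq (β : R → ℝ) :
    (∑ x₁, ∑ x₂, ∑ x₃, ∑ x₄, if x₁ + x₂ = x₃ + x₄ then
      β (x₁ ^ 2) * β (x₂ ^ 2) * β (x₃ ^ 2) * β (x₄ ^ 2) else 0) =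
      ∑ l, shiftWeight β l ^ 2 := by
  have h1 : ∀ l, shiftWeight β l ^ 2 =
      ∑ x, ∑ y, β (x ^ 2) * β ((x + l) ^ 2) * (β (y ^ 2) * β ((y + l) ^ 2)) := fun l => by
    rw [sq, shiftWeight, Finset.sum_mul_sum]
  simp_rw [h1]
  conv_rhs => rw [Finset.sum_comm]
  refine Finset.sum_congr rfl fun x₁ _ => ?_
  rw [Finset.sum_comm, ← Equiv.sum_comp (Equiv.addLeft x₁)]
  refine Finset.sum_congr rfl fun l _ => ?_
  rw [Finset.sum_comm]
  refine Finset.sum_congr rfl fun x₄ _ => ?_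
  have h2 : ∀ x₂, x₁ + x₂ = x₁ + l + x₄ ↔ x₂ = x₄ + l := fun x₂ => by
    rw [add_assoc, add_right_inj, add_comm l]
  simp only [Equiv.coe_addLeft, h2, Finset.sum_ite_eq', Finset.mem_univ, if_true]
  ring

theorem sum_comp_sq_le [IsDomain R] {β : R → ℝ} (hβ : ∀ x, 0 ≤ β x) :
    ∑ x, β (x ^ 2) ≤ 2 * ∑ x, β x := by
  classical
  rw [Finset.sum_comp β (fun x : R => x ^ 2), Finset.mul_sum]
  refine (Finset.sum_le_sum (g := fun y => 2 * β y) fun y hy => ?_).trans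
    (Finset.sum_le_sum_of_subset_of_nonneg (Finset.subset_univ _)
      fun x _ _ => mul_nonneg zero_le_two (hβ x))
  rw [nsmul_eq_mul]
  refine mul_le_mul_of_nonneg_right ?_ (hβ y)
  obtain ⟨z, -, rfl⟩ := Finset.mem_image.1 hy
  have hsub : (Finset.univ.filter fun x : R => x ^ 2 = z ^ 2) ⊆ {z, -z} := by
    intro x hx
    simpa using sq_eq_sq_iff_eq_or_eq_neg.1 (Finset.mem_filter.1 hx).2
  exact_mod_cast (Finset.card_le_card hsub).trans Finset.card_le_two

theorem sum_shiftWeight_le [IsDomain R] {β : R → ℝ} (hβ : ∀ x, 0 ≤ β x) :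
    ∑ l, shiftWeight β l ≤ 4 * (∑ x, β x) ^ 2 := by
  rw [sum_shiftWeight]
  have h0 : 0 ≤ ∑ x, β (x ^ 2) := Finset.sum_nonneg fun _ _ => hβ _
  calc (∑ x, β (x ^ 2)) ^ 2 ≤ (2 * ∑ x, β x) ^ 2 := pow_le_pow_left₀ h0 (sum_comp_sq_le hβ) 2
    _ = _ := by ring

theorem shiftWeight_zero_sq_le [IsDomain R] {β : R → ℝ} (hβ : ∀ x, 0 ≤ β x) {M : ℝ}
    (hM : ∀ x, β x ≤ M) : shiftWeight β 0 ^ 2 ≤ 4 * M ^ 2 * (∑ x, β x) ^ 2 := by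
  have hM0 : 0 ≤ M := (hβ 0).trans (hM 0)
  have h : shiftWeight β 0 ≤ M * (2 * ∑ x, β x) := by
    refine le_trans ?_ (mul_le_mul_of_nonneg_left (sum_comp_sq_le hβ) hM0)
    rw [Finset.mul_sum]
    exact Finset.sum_le_sum fun x _ => mul_le_mul_of_nonneg_right (hM _) (hβ _) |>.trans_eq
      (by rw [add_zero])
  calc shiftWeight β 0 ^ 2 ≤ (M * (2 * ∑ x, β x)) ^ 2 :=
        pow_le_pow_left₀ (shiftWeight_nonneg hβ 0) h 2
    _ = _ := by ring

open Classical in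
theorem shiftWeight_le {K : Type u} [Field K] {φ : K[X] →+* R} {m : ℕ} {β : R → ℝ}
    (hβ : ∀ x, 0 ≤ β x) {M : ℝ} (hM : ∀ x, β x ≤ M)
    (hsupp : ∀ x, β x ≠ 0 → x ∈ φ '' {p | p.degree < m}) (l : R) :
    shiftWeight β l ≤ M ^ 2 * (Finset.univ.filter (· ∈ sqrtShift φ m l)).card := by
  have hM0 : 0 ≤ M := (hβ 0).trans (hM 0)
  unfold shiftWeight
  rw [← Finset.sum_filter_of_ne (p := (· ∈ sqrtShift φ m l))]
  · refine (Finset.sum_le_card_nsmul _ _ (M ^ 2) fun x _ => ?_).trans_eq (by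
      rw [nsmul_eq_mul, mul_comm])
    rw [sq M]
    exact mul_le_mul (hM _) (hM _) (hβ _) hM0
  · intro x _ hx
    exact ⟨hsupp _ (left_ne_zero_of_mul hx), hsupp _ (right_ne_zero_of_mul hx)⟩

theorem sum_le_mul_of_support {K : Type u} [Field K] [Finite K] {φ : K[X] →+* R} {m : ℕ}
    {β : R → ℝ} {M : ℝ} (hM : ∀ x, β x ≤ M) (hM0 : 0 ≤ M)
    (hsupp : ∀ x, β x ≠ 0 → x ∈ φ '' {p | p.degree < m}) :
    ∑ x, β x ≤ (Nat.card K : ℝ) ^ m * M := by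
  classical
  rw [← Finset.sum_filter_ne_zero]
  refine (Finset.sum_le_card_nsmul _ _ M fun x _ => hM x).trans ?_
  rw [nsmul_eq_mul]
  refine mul_le_mul_of_nonneg_right ?_ hM0
  have h : (Finset.univ.filter fun x => β x ≠ 0) ⊆ (polyDegLT K m).image φ := by
    intro x hx
    obtain ⟨p, hp, rfl⟩ := hsupp x (Finset.mem_filter.1 hx).2
    exact Finset.mem_image_of_mem _ (mem_polyDegLT.2 hp)
  have := (Finset.card_le_card h).trans Finset.card_image_le
  rw [card_polyDegLT] at this
  exact_mod_cast this

open Classical in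
/-- Either few `x` have `x ^ 2` and `(x + l) ^ 2` both small, or `l ^ 2` is a quotient of
polynomials of low degree. -/
theorem card_sqrtShift_sq_le_or [IsDomain R] {K : Type u} [Field K] [Finite K] {φ : K[X] →+* R}
    {F : K[X]} (hF : F ≠ 0) (hφ : ∀ p, φ p = 0 ↔ F ∣ p) {m : ℕ} (hm : m ≤ F.natDegree)
    (h2K : (2 : K) ≠ 0) (h2 : (2 : R) ≠ 0) {l : R} (hl : l ≠ 0) :
    ((Finset.univ.filter (· ∈ sqrtShift φ m l)).card : ℝ) ^ 2 ≤
        4 + 4 * divisorBound (Nat.card K) (2 * m) *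
          ((Nat.card K : ℝ) ^ (3 * m) / (Nat.card K : ℝ) ^ F.natDegree) ∨
      ∃ h ∈ Finset.Icc 1 m, IsShortSqrt φ m h l ∧
        ((Finset.univ.filter (· ∈ sqrtShift φ m l)).card : ℝ) ^ 2 ≤
          8 * divisorBound (Nat.card K) (2 * m) * (Nat.card K : ℝ) ^ h := by
  have key := card_sqrtShift_sq_le hφ hm h2K h2 hl
  set J := (Finset.univ.filter (· ∈ sqrtShift φ m l)).card
  set D := divisorBound (Nat.card K) (2 * m)
  have hq : 1 ≤ Nat.card K := Nat.card_pos
  have hq' : (1 : ℝ) ≤ Nat.card K := by exact_mod_cast hq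
  have hD : (1 : ℝ) ≤ D := by exact_mod_cast one_le_divisorBound hq (2 * m)
  set Q : ℝ := (Nat.card K : ℝ) ^ (3 * m) / (Nat.card K : ℝ) ^ F.natDegree with hQ
  have hQ0 : 0 ≤ Q := by positivity
  have keyR : (J : ℝ) ^ 2 ≤ 2 * J +
      D * ((boxLattice φ m (l ^ 2)).filter fun u => u.2 ≠ 0).card := by exact_mod_cast key
  rcases Finset.eq_empty_or_nonempty ((boxLattice φ m (l ^ 2)).filter fun u => u.2 ≠ 0)
    with he | ⟨⟨X, Y⟩, hXY⟩
  · left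
    rw [he, Finset.card_empty, Nat.cast_zero, mul_zero, add_zero] at keyR
    have : 0 ≤ 4 * (D : ℝ) * Q := by positivity
    nlinarith [sq_nonneg ((J : ℝ) - 2)]
  obtain ⟨hXY, hY⟩ := Finset.mem_filter.1 hXY
  obtain ⟨b, c, hbc, hc, hcop⟩ := exists_primitive_of_mem_boxLattice hφ hm hXY hY
  obtain ⟨⟨hb', hc'⟩, hbcφ⟩ := mem_boxLattice.1 hbc
  simp only at hb' hc' hbcφ
  have hφc : φ c ≠ 0 := by
    intro h
    have h3 := natDegree_le_of_dvd ((hφ _).1 h) hc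
    rw [← natDegree_lt_iff_degree_lt hc] at hc'
    omega
  have hb : b ≠ 0 := by
    rintro rfl
    rw [map_zero, eq_comm] at hbcφ
    exact mul_ne_zero (pow_ne_zero _ hl) hφc hbcφ
  rw [← natDegree_lt_iff_degree_lt hc] at hc'
  rw [← natDegree_lt_iff_degree_lt hb] at hb'
  -- h is the room left in the box for multiples of (b, c); strict degree bounds give h ≥ 1.
  obtain ⟨h, hh1, hbh, hch, hh⟩ : ∃ h, 1 ≤ h ∧ b.natDegree + h ≤ 2 * m ∧ c.natDegree + h ≤ m ∧
      (2 * m ≤ b.natDegree + h ∨ m ≤ c.natDegree + h) :=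
    ⟨min (2 * m - b.natDegree) (m - c.natDegree), by omega, by omega, by omega, by omega⟩
  have hcard := card_boxLattice_le hF hφ hc hcop hbcφ hbh hch (hh.imp (fun h => ⟨h, hb⟩) id)
  have hcardR : ((boxLattice φ m (l ^ 2)).card : ℝ) ≤ (Nat.card K : ℝ) ^ h + Q := by
    have h1 : ((boxLattice φ m (l ^ 2)).card : ℝ) ≤
      (Nat.card K : ℝ) ^ h * (Nat.card K : ℝ) ^ (3 * m - h - F.natDegree) := by exact_mod_cast hcard
    refine h1.trans ?_
    rcases Nat.le_total (3 * m) (h + F.natDegree) with h3 | h3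
    · rw [show 3 * m - h - F.natDegree = 0 by omega, pow_zero, mul_one]
      linarith
    · rw [← pow_add, hQ, show 3 * m = (h + (3 * m - h - F.natDegree)) + F.natDegree by omega,
        pow_add _ _ F.natDegree, mul_div_assoc, div_self (by positivity), mul_one]
      rw [show h + (h + (3 * m - h - F.natDegree) + F.natDegree - h - F.natDegree) =
        h + (3 * m - h - F.natDegree) by omega]
      have : (0 : ℝ) ≤ (Nat.card K : ℝ) ^ h := by positivity
      linarith
  have hPR : ((((boxLattice φ m (l ^ 2)).filter fun u => u.2 ≠ 0).card : ℕ) : ℝ) ≤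
      (Nat.card K : ℝ) ^ h + Q :=
    le_trans (by exact_mod_cast Finset.card_filter_le _ _) hcardR
  -- The linear term is absorbed by 2J ≤ J²/2 + 2.
  have h4 : (J : ℝ) ^ 2 ≤ 4 + 2 * (D * ((Nat.card K : ℝ) ^ h + Q)) := by
    have := mul_le_mul_of_nonneg_left hPR (by positivity : (0 : ℝ) ≤ D)
    nlinarith [sq_nonneg ((J : ℝ) - 2)]
  rcases le_total ((Nat.card K : ℝ) ^ h) Q with h5 | h5
  · left
    have := mul_le_mul_of_nonneg_left h5 (by positivity : (0 : ℝ) ≤ D)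
    linarith
  · right
    refine ⟨h, Finset.mem_Icc.2 ⟨hh1, by omega⟩, ⟨b, c, hφc, hbcφ, ?_, ?_⟩, ?_⟩
    · rw [← natDegree_lt_iff_degree_lt hb]; omega
    · rw [← natDegree_lt_iff_degree_lt hc]; omega
    · have h6 := mul_le_mul_of_nonneg_left h5 (by positivity : (0 : ℝ) ≤ D)
      have h7 : (1 : ℝ) ≤ D * (Nat.card K : ℝ) ^ h :=
        one_le_mul_of_one_le_of_one_le hD (one_le_pow₀ hq')
      linarith

/-- Pointwise interpolation between first and fourth moments, split at x = t. -/
theorem sq_le_mul_add_pow_four_div {x t : ℝ} (hx : 0 ≤ x) (ht : 0 < t) :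
    x ^ 2 ≤ t * x + x ^ 4 / t ^ 2 := by
  rcases le_total x t with h | h
  · have : 0 ≤ x ^ 4 / t ^ 2 := by positivity
    nlinarith
  · have h1 : x ^ 2 ≤ x ^ 4 / t ^ 2 := by
      rw [le_div_iff₀ (by positivity)]
      have := mul_le_mul_of_nonneg_left (pow_le_pow_left₀ ht.le h 2) (sq_nonneg x)
      calc _ ≤ _ := this
        _ = _ := by ring
    nlinarith [mul_nonneg ht.le hx]

open Classical in
-- One nonnegative term for each regime: l = 0, generic l, and l with l² a short quotient. Only the
-- last uses the threshold t.
theorem shiftWeight_sq_le [IsDomain R] {K : Type u} [Field K] [Finite K] {φ : K[X] →+* R}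
    {F : K[X]} (hF : F ≠ 0) (hφ : ∀ p, φ p = 0 ↔ F ∣ p) {m : ℕ} (hm : m ≤ F.natDegree)
    (h2K : (2 : K) ≠ 0) (h2 : (2 : R) ≠ 0) {β : R → ℝ} (hβ : ∀ x, 0 ≤ β x) {M : ℝ}
    (hM : ∀ x, β x ≤ M) (hsupp : ∀ x, β x ≠ 0 → x ∈ φ '' {p | p.degree < m}) {t : ℝ} (ht : 0 < t)
    (l : R) :
    shiftWeight β l ^ 2 ≤
      (if l = 0 then 4 * M ^ 2 * (∑ x, β x) ^ 2 else 0) +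
      M ^ 2 * (2 + 2 * divisorBound (Nat.card K) (2 * m) *
        √((Nat.card K : ℝ) ^ (3 * m) / (Nat.card K : ℝ) ^ F.natDegree)) * shiftWeight β l +
      (t * shiftWeight β l +
        M ^ 8 * (∑ h ∈ Finset.Icc 1 m, if IsShortSqrt φ m h l then
          64 * (divisorBound (Nat.card K) (2 * m) : ℝ) ^ 2 * (Nat.card K : ℝ) ^ (2 * h)
          else 0) / t ^ 2) := by
  have hq : 1 ≤ Nat.card K := Nat.card_pos
  have hD : (1 : ℝ) ≤ divisorBound (Nat.card K) (2 * m) := by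
    exact_mod_cast one_le_divisorBound hq (2 * m)
  have hM0 : 0 ≤ M := (hβ 0).trans (hM 0)
  have hJ0 := shiftWeight_nonneg hβ l
  have hJ := shiftWeight_le hβ hM hsupp l
  have hsum0 : ∀ h ∈ Finset.Icc 1 m, (0 : ℝ) ≤ if IsShortSqrt φ m h l then
      64 * (divisorBound (Nat.card K) (2 * m) : ℝ) ^ 2 * (Nat.card K : ℝ) ^ (2 * h) else 0 := by
    intro h _
    split_ifs
    · positivity
    · exact le_rfl
  have hS0 := Finset.sum_nonneg hsum0
  by_cases hl : l = 0
  · subst hl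
    rw [if_pos rfl]
    have := shiftWeight_zero_sq_le hβ hM
    have : 0 ≤ M ^ 2 * (2 + 2 * divisorBound (Nat.card K) (2 * m) *
        √((Nat.card K : ℝ) ^ (3 * m) / (Nat.card K : ℝ) ^ F.natDegree)) * shiftWeight β 0 := by
      positivity
    have : 0 ≤ (t * shiftWeight β 0 +
        M ^ 8 * (∑ h ∈ Finset.Icc 1 m, if IsShortSqrt φ m h 0 then
          64 * (divisorBound (Nat.card K) (2 * m) : ℝ) ^ 2 * (Nat.card K : ℝ) ^ (2 * h)
          else 0) / t ^ 2) := by positivity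
    linarith
  rw [if_neg hl, zero_add]
  rcases card_sqrtShift_sq_le_or hF hφ hm h2K h2 hl with h | ⟨h, hh, hsh, hle⟩
  · have h1 : ((Finset.univ.filter (· ∈ sqrtShift φ m l)).card : ℝ) ≤
        2 + 2 * divisorBound (Nat.card K) (2 * m) *
        √((Nat.card K : ℝ) ^ (3 * m) / (Nat.card K : ℝ) ^ F.natDegree) := by
      refine abs_le_of_sq_le_sq' (h.trans ?_) (by positivity) |>.2
      have h2 := Real.sq_sqrt (show (0 : ℝ) ≤
        (Nat.card K : ℝ) ^ (3 * m) / (Nat.card K : ℝ) ^ F.natDegree by positivity)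
      set s := √((Nat.card K : ℝ) ^ (3 * m) / (Nat.card K : ℝ) ^ F.natDegree) with hs
      have hs0 : 0 ≤ s := Real.sqrt_nonneg _
      rw [← h2]
      have h3 := mul_le_mul_of_nonneg_right hD
        (by positivity : (0 : ℝ) ≤ divisorBound (Nat.card K) (2 * m) * s ^ 2)
      have h4 : 0 ≤ (divisorBound (Nat.card K) (2 * m) : ℝ) * s := by positivity
      nlinarith
    have h2 : shiftWeight β l ^ 2 ≤ M ^ 2 * (2 + 2 * divisorBound (Nat.card K) (2 * m) *
        √((Nat.card K : ℝ) ^ (3 * m) / (Nat.card K : ℝ) ^ F.natDegree)) * shiftWeight β l := by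
      rw [sq]
      exact mul_le_mul_of_nonneg_right
        (hJ.trans (mul_le_mul_of_nonneg_left h1 (by positivity))) hJ0
    have : 0 ≤ (t * shiftWeight β l +
        M ^ 8 * (∑ h ∈ Finset.Icc 1 m, if IsShortSqrt φ m h l then
          64 * (divisorBound (Nat.card K) (2 * m) : ℝ) ^ 2 * (Nat.card K : ℝ) ^ (2 * h)
          else 0) / t ^ 2) := by positivity
    linarith
  · have h1 : shiftWeight β l ^ 4 ≤ M ^ 8 * (∑ h ∈ Finset.Icc 1 m, if IsShortSqrt φ m h l then
          64 * (divisorBound (Nat.card K) (2 * m) : ℝ) ^ 2 * (Nat.card K : ℝ) ^ (2 * h)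
          else 0) := by
      have h2 := Finset.single_le_sum hsum0 hh
      rw [if_pos hsh] at h2
      refine le_trans ?_ (mul_le_mul_of_nonneg_left h2 (by positivity))
      calc shiftWeight β l ^ 4 ≤
          (M ^ 2 * (Finset.univ.filter (· ∈ sqrtShift φ m l)).card) ^ 4 :=
            pow_le_pow_left₀ hJ0 hJ 4
        _ = M ^ 8 * (((Finset.univ.filter (· ∈ sqrtShift φ m l)).card : ℝ) ^ 2) ^ 2 := by ring
        _ ≤ M ^ 8 * (8 * divisorBound (Nat.card K) (2 * m) * (Nat.card K : ℝ) ^ h) ^ 2 := by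
            gcongr
        _ = _ := by ring
    have h2 : 0 ≤ M ^ 2 * (2 + 2 * divisorBound (Nat.card K) (2 * m) *
        √((Nat.card K : ℝ) ^ (3 * m) / (Nat.card K : ℝ) ^ F.natDegree)) * shiftWeight β l := by
      positivity
    have h3 := sq_le_mul_add_pow_four_div hJ0 ht
    have h4 := div_le_div_of_nonneg_right h1 (sq_nonneg t)
    linarith

theorem sum_shiftWeight_sq_le_of_pos [IsDomain R] {K : Type u} [Field K] [Finite K]
    {φ : K[X] →+* R} {F : K[X]} (hF : F ≠ 0) (hφ : ∀ p, φ p = 0 ↔ F ∣ p) {m : ℕ}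
    (hm : m ≤ F.natDegree) (h2K : (2 : K) ≠ 0) (h2 : (2 : R) ≠ 0) {β : R → ℝ}
    (hβ : ∀ x, 0 ≤ β x) {M : ℝ} (hM : ∀ x, β x ≤ M)
    (hsupp : ∀ x, β x ≠ 0 → x ∈ φ '' {p | p.degree < m}) {t : ℝ} (ht : 0 < t) :
    ∑ l, shiftWeight β l ^ 2 ≤
      4 * M ^ 2 * (∑ x, β x) ^ 2 +
      M ^ 2 * (2 + 2 * divisorBound (Nat.card K) (2 * m) *
        √((Nat.card K : ℝ) ^ (3 * m) / (Nat.card K : ℝ) ^ F.natDegree)) *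
          (4 * (∑ x, β x) ^ 2) +
      (t * (4 * (∑ x, β x) ^ 2) +
        M ^ 8 * (m * (128 * (divisorBound (Nat.card K) (2 * m) : ℝ) ^ 2 *
          (Nat.card K : ℝ) ^ (3 * m + 2))) / t ^ 2) := by
  classical
  have hM0 : 0 ≤ M := (hβ 0).trans (hM 0)
  have hsum := sum_shiftWeight_le hβ
  -- The weight q^{2h} cancels the scarcity of short roots at level h, so all m levels contribute
  -- equally.
  have hfour : ∑ l : R, ∑ h ∈ Finset.Icc 1 m, (if IsShortSqrt φ m h l then
      64 * (divisorBound (Nat.card K) (2 * m) : ℝ) ^ 2 * (Nat.card K : ℝ) ^ (2 * h) else 0) ≤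
      m * (128 * (divisorBound (Nat.card K) (2 * m) : ℝ) ^ 2 *
          (Nat.card K : ℝ) ^ (3 * m + 2)) := by
    rw [Finset.sum_comm]
    refine (Finset.sum_le_card_nsmul _ _ (128 * (divisorBound (Nat.card K) (2 * m) : ℝ) ^ 2 *
          (Nat.card K : ℝ) ^ (3 * m + 2)) fun h hh => ?_).trans_eq (by simp)
    rw [← Finset.sum_filter, Finset.sum_const, nsmul_eq_mul]
    have h1 : ((Finset.univ.filter (IsShortSqrt φ m h)).card : ℝ) * (Nat.card K : ℝ) ^ (2 * h) ≤
        2 * (Nat.card K : ℝ) ^ (3 * m + 2) := by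
      exact_mod_cast card_isShortSqrt_le φ (Finset.mem_Icc.1 hh).2
    have h2 := mul_le_mul_of_nonneg_left h1
      (by positivity : (0 : ℝ) ≤ 64 * (divisorBound (Nat.card K) (2 * m) : ℝ) ^ 2)
    calc _ = _ := by ring
      _ ≤ _ := h2
      _ = _ := by ring
  refine (Finset.sum_le_sum fun l _ =>
    shiftWeight_sq_le hF hφ hm h2K h2 hβ hM hsupp ht l).trans ?_
  rw [Finset.sum_add_distrib, Finset.sum_add_distrib, Finset.sum_add_distrib, ← Finset.mul_sum,
    ← Finset.mul_sum, ← Finset.sum_div, ← Finset.mul_sum, Finset.sum_ite_eq' Finset.univ (0 : R),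
    if_pos (Finset.mem_univ _)]
  gcongr

end Energy

/-- In the cube roots b, μ, n of ‖β‖₁, M, q^m all exponents are integers. The threshold μ⁸n³/b²
balances the first and fourth moment terms; 152 = 16 + 8 + 128 collects the constants. -/
theorem energy_terms_le {b μ n s W D c m : ℝ} (hb : 0 < b) (hμ : 0 < μ) (hn : 1 ≤ n) (hW : 0 ≤ W)
    (hD : 1 ≤ D) (hc : 1 ≤ c) (hm : 1 ≤ m) (hbn : b ≤ n * μ) (hs : n ^ 2 * s = n ^ 3 * W)
    (hs0 : 0 ≤ s) :
    4 * (μ ^ 3) ^ 2 * (b ^ 3) ^ 2 + (μ ^ 3) ^ 2 * (2 + 2 * D * s) * (4 * (b ^ 3) ^ 2) +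
      (μ ^ 8 * n ^ 3 / b ^ 2 * (4 * (b ^ 3) ^ 2) +
        (μ ^ 3) ^ 8 * (m * (128 * D ^ 2 * (n ^ 9 * c))) / (μ ^ 8 * n ^ 3 / b ^ 2) ^ 2) ≤
      b ^ 4 * μ ^ 8 * (n ^ 3 * (152 * c * m * D ^ 2)) * (W + 1) := by
  have hn0 : 0 < n := by linarith
  have hD0 : 0 < D := by linarith
  have h1 : b ^ 6 * μ ^ 6 ≤ b ^ 4 * μ ^ 8 * n ^ 2 := by
    have h := pow_le_pow_left₀ hb.le hbn 2
    calc b ^ 6 * μ ^ 6 = b ^ 4 * μ ^ 6 * b ^ 2 := by ring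
      _ ≤ b ^ 4 * μ ^ 6 * (n * μ) ^ 2 := by gcongr
      _ = _ := by ring
  have h2 : b ^ 4 * μ ^ 8 * n ^ 2 ≤ b ^ 4 * μ ^ 8 * n ^ 3 := by
    gcongr
    norm_num
  have e1 : μ ^ 8 * n ^ 3 / b ^ 2 * (4 * (b ^ 3) ^ 2) = 4 * (b ^ 4 * μ ^ 8 * n ^ 3) := by
    field_simp
  have e2 : (μ ^ 3) ^ 8 * (m * (128 * D ^ 2 * (n ^ 9 * c))) / (μ ^ 8 * n ^ 3 / b ^ 2) ^ 2 =
      b ^ 4 * μ ^ 8 * n ^ 3 * (128 * (c * m * D ^ 2)) := by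
    field_simp
  have h3 : (μ ^ 3) ^ 2 * (2 + 2 * D * s) * (4 * (b ^ 3) ^ 2) ≤
      b ^ 4 * μ ^ 8 * n ^ 3 * (8 + 8 * D * W) := by
    calc (μ ^ 3) ^ 2 * (2 + 2 * D * s) * (4 * (b ^ 3) ^ 2)
        = b ^ 6 * μ ^ 6 * (8 + 8 * D * s) := by ring
      _ ≤ b ^ 4 * μ ^ 8 * n ^ 2 * (8 + 8 * D * s) := by gcongr
      _ = 8 * (b ^ 4 * μ ^ 8 * n ^ 2) + b ^ 4 * μ ^ 8 * (8 * D) * (n ^ 2 * s) := by ring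
      _ ≤ 8 * (b ^ 4 * μ ^ 8 * n ^ 3) + b ^ 4 * μ ^ 8 * (8 * D) * (n ^ 3 * W) := by
        rw [hs]; gcongr
      _ = _ := by ring
  have h4 : 4 * (μ ^ 3) ^ 2 * (b ^ 3) ^ 2 ≤ 4 * (b ^ 4 * μ ^ 8 * n ^ 3) := by
    calc 4 * (μ ^ 3) ^ 2 * (b ^ 3) ^ 2 = 4 * (b ^ 6 * μ ^ 6) := by ring
      _ ≤ _ := by linarith
  rw [e1, e2]
  have hcm : 1 ≤ c * m := one_le_mul_of_one_le_of_one_le hc hm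
  have h5 : D ≤ c * m * D ^ 2 := by
    calc D = 1 * (D * 1) := by ring
      _ ≤ c * m * (D * D) := by gcongr
      _ = _ := by ring
  have h6 : 16 + 8 * D * W + 128 * (c * m * D ^ 2) ≤ 152 * (c * m * D ^ 2) * (W + 1) := by
    have := mul_le_mul_of_nonneg_right h5 hW
    have : 0 ≤ c * m * D ^ 2 * W := by positivity
    nlinarith
  calc _ ≤ b ^ 4 * μ ^ 8 * n ^ 3 * (16 + 8 * D * W + 128 * (c * m * D ^ 2)) := by linarith
    _ ≤ b ^ 4 * μ ^ 8 * n ^ 3 * (152 * (c * m * D ^ 2) * (W + 1)) := by gcongr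
    _ = _ := by ring

theorem sum_shiftWeight_sq_le {R : Type u} [CommRing R] [Fintype R] [IsDomain R] {K : Type u}
    [Field K] [Finite K] {φ : K[X] →+* R} {F : K[X]} (hF : F ≠ 0) (hφ : ∀ p, φ p = 0 ↔ F ∣ p)
    {m : ℕ} (hm0 : 0 < m) (hm : m ≤ F.natDegree) (h2K : (2 : K) ≠ 0) (h2 : (2 : R) ≠ 0)
    {β : R → ℝ} (hβ : ∀ x, 0 ≤ β x) {M : ℝ} (hM : ∀ x, β x ≤ M)
    (hsupp : ∀ x, β x ≠ 0 → x ∈ φ '' {p | p.degree < m}) :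
    ∑ l, shiftWeight β l ^ 2 ≤
      (∑ x, β x) ^ (4 / 3 : ℝ) * M ^ (8 / 3 : ℝ) *
        ((Nat.card K : ℝ) ^ m *
          (152 * (Nat.card K : ℝ) ^ 2 * m * (divisorBound (Nat.card K) (2 * m) : ℝ) ^ 2)) *
        ((Nat.card K : ℝ) ^ (7 * (m : ℝ) / 6 - (F.natDegree : ℝ) / 2) + 1) := by
  have hq : 1 ≤ Nat.card K := Nat.card_pos
  have hq1 : (1 : ℝ) ≤ Nat.card K := by exact_mod_cast hq
  have hq0 : (0 : ℝ) < Nat.card K := by linarith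
  have hM0 : 0 ≤ M := (hβ 0).trans (hM 0)
  have hB0 : 0 ≤ ∑ x, β x := Finset.sum_nonneg fun x _ => hβ x
  have hBM := sum_le_mul_of_support hM hM0 hsupp
  -- The zero weight is treated apart because the threshold divides by b².
  rcases hB0.eq_or_lt with hB | hB
  · have h := sum_shiftWeight_le hβ
    rw [← hB] at h ⊢
    rw [Real.zero_rpow (by norm_num), zero_mul, zero_mul, zero_mul]
    refine (Finset.sum_eq_zero fun l hl => ?_).le
    have h1 := (Finset.single_le_sum (fun i _ => shiftWeight_nonneg hβ i) hl).trans h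
    have h2 := shiftWeight_nonneg hβ l
    have : shiftWeight β l = 0 := by linarith
    rw [this]; ring
  have hMpos : 0 < M := by
    rcases hM0.eq_or_lt with h | h
    · rw [← h, mul_zero] at hBM; linarith
    · exact h
  set B := ∑ x, β x
  set q : ℝ := (Nat.card K : ℝ)
  have hroot : ∀ x : ℝ, 0 ≤ x → (x ^ (1 / 3 : ℝ)) ^ 3 = x := fun x hx => by
    rw [← Real.rpow_natCast, ← Real.rpow_mul hx]; norm_num
  set b := B ^ (1 / 3 : ℝ) with hb
  set μ := M ^ (1 / 3 : ℝ) with hμ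
  set n := (q ^ m) ^ (1 / 3 : ℝ) with hn
  set s := √(q ^ (3 * m) / q ^ F.natDegree) with hs
  have hb0 : 0 < b := Real.rpow_pos_of_pos hB _
  have hμ0 : 0 < μ := Real.rpow_pos_of_pos hMpos _
  have hn1 : 1 ≤ n := Real.one_le_rpow (one_le_pow₀ hq1) (by norm_num)
  have hb3 : b ^ 3 = B := hroot B hB0
  have hμ3 : μ ^ 3 = M := hroot M hM0
  have hn3 : n ^ 3 = q ^ m := hroot _ (by positivity)
  have hbn : b ≤ n * μ := by
    refine le_of_pow_le_pow_left₀ (n := 3) (by norm_num) (by positivity) ?_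
    rw [mul_pow, hb3, hμ3, hn3]; exact hBM
  have hb4 : B ^ (4 / 3 : ℝ) = b ^ 4 := by
    rw [hb, ← Real.rpow_natCast, ← Real.rpow_mul hB0]; norm_num
  have hμ8 : M ^ (8 / 3 : ℝ) = μ ^ 8 := by
    rw [hμ, ← Real.rpow_natCast, ← Real.rpow_mul hM0]; norm_num
  -- This is 2/3 + 3/2 = 1 + 7/6 in the exponent of q.
  have hns : n ^ 2 * s = n ^ 3 * q ^ (7 * (m : ℝ) / 6 - (F.natDegree : ℝ) / 2) := by
    rw [hn3, hn, hs, Real.sqrt_eq_rpow, ← Real.rpow_natCast q (3 * m),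
      ← Real.rpow_natCast q F.natDegree, ← Real.rpow_sub hq0, ← Real.rpow_mul hq0.le,
      ← Real.rpow_natCast q m, ← Real.rpow_mul hq0.le, ← Real.rpow_natCast (q ^ _) 2,
      ← Real.rpow_mul hq0.le, ← Real.rpow_add hq0, ← Real.rpow_add hq0]
    congr 1
    push_cast
    ring
  have hD : (1 : ℝ) ≤ divisorBound (Nat.card K) (2 * m) := by
    exact_mod_cast one_le_divisorBound hq (2 * m)
  have hm1 : (1 : ℝ) ≤ m := by exact_mod_cast hm0
  have ht : 0 < μ ^ 8 * n ^ 3 / b ^ 2 := by positivity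
  refine (sum_shiftWeight_sq_le_of_pos hF hφ hm h2K h2 hβ hM hsupp ht).trans ?_
  have key := energy_terms_le hb0 hμ0 hn1
    (Real.rpow_nonneg hq0.le (7 * (m : ℝ) / 6 - (F.natDegree : ℝ) / 2)) hD
    (one_le_pow₀ hq1 : 1 ≤ q ^ 2) hm1 hbn hns (Real.sqrt_nonneg _)
  have hn9 : n ^ 9 * q ^ 2 = q ^ (3 * m + 2) := by
    rw [show n ^ 9 = (n ^ 3) ^ 3 by ring, hn3]; ring
  rw [hn9, hb3, hμ3] at key
  rw [hb4, hμ8, ← hn3]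
  exact key

/-! ### From polynomials of degree < r to the quotient ring -/

section Transfer

variable {K : Type u} [Field K]

theorem mk_mod (F x : K[X]) :
    Ideal.Quotient.mk (Ideal.span {F}) (x % F) = Ideal.Quotient.mk (Ideal.span {F}) x := by
  rw [Ideal.Quotient.eq, Ideal.mem_span_singleton, EuclideanDomain.mod_eq_sub_mul_div]
  exact ⟨-(x / F), by ring⟩

theorem sum_polyDegLT_comp_mk [Finite K] {F : K[X]} (hF : F ≠ 0) [Fintype (K[X] ⧸ Ideal.span {F})]
    {A : Type*} [AddCommMonoid A] (f : (K[X] ⧸ Ideal.span {F}) → A) :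
    ∑ x ∈ polyDegLT K F.natDegree, f (Ideal.Quotient.mk (Ideal.span {F}) x) = ∑ x, f x := by
  refine Finset.sum_nbij (Ideal.Quotient.mk (Ideal.span {F})) (fun _ _ => Finset.mem_univ _) ?_ ?_
    (fun _ _ => rfl)
  · intro x hx y hy hxy
    rw [Ideal.Quotient.eq, Ideal.mem_span_singleton] at hxy
    have hx' := mem_polyDegLT.1 hx
    have hy' := mem_polyDegLT.1 hy
    rw [← degree_eq_natDegree hF] at hx' hy'
    exact sub_eq_zero.1 (eq_zero_of_dvd_of_degree_lt hxy
      ((degree_sub_le _ _).trans_lt (max_lt hx' hy')))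
  · intro y _
    obtain ⟨x, rfl⟩ := Ideal.Quotient.mk_surjective y
    refine ⟨x % F, mem_polyDegLT.2 ?_, ?_⟩
    · rw [← degree_eq_natDegree hF]
      exact EuclideanDomain.mod_lt x hF
    · exact mk_mod F x

open Classical in
theorem sqrtEnergy_eq_sum [Finite K] {F : K[X]} (hF : F ≠ 0) [Fintype (K[X] ⧸ Ideal.span {F})]
    (α : (K[X] ⧸ Ideal.span {F}) → ℂ) :
    sqrtEnergy F α = ∑ x₁, ∑ x₂, ∑ x₃, ∑ x₄, if x₁ + x₂ = x₃ + x₄ then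
      α (x₁ ^ 2) * (starRingEnd ℂ) (α (x₂ ^ 2)) * α (x₃ ^ 2) * (starRingEnd ℂ) (α (x₄ ^ 2))
      else 0 := by
  rw [← sum_polyDegLT_comp_mk hF]
  refine Finset.sum_congr rfl fun x₁ _ => ?_
  rw [← sum_polyDegLT_comp_mk hF]
  refine Finset.sum_congr rfl fun x₂ _ => ?_
  rw [← sum_polyDegLT_comp_mk hF]
  refine Finset.sum_congr rfl fun x₃ _ => ?_
  rw [← sum_polyDegLT_comp_mk hF]
  refine Finset.sum_congr rfl fun x₄ _ => ?_
  refine if_congr ?_ (by simp only [weightAt, map_pow]) rfl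
  rw [← map_add, ← map_add, Ideal.Quotient.eq, Ideal.mem_span_singleton]

/-- Conjugation amounts to exchanging x₁ with x₂ and x₃ with x₄, which preserves the congruence. -/
theorem sqrtEnergy_im [Finite K] (F : K[X]) (α : (K[X] ⧸ Ideal.span {F}) → ℂ) :
    (sqrtEnergy F α).im = 0 := by
  rw [← Complex.conj_eq_iff_im]
  unfold sqrtEnergy
  simp only [map_sum]
  rw [Finset.sum_comm]
  refine Finset.sum_congr rfl fun x₁ _ => Finset.sum_congr rfl fun x₂ _ => ?_
  rw [Finset.sum_comm]
  refine Finset.sum_congr rfl fun x₃ _ => Finset.sum_congr rfl fun x₄ _ => ?_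
  rw [apply_ite (starRingEnd ℂ), map_zero, add_comm x₂, add_comm x₄]
  split_ifs
  · simp only [map_mul, Complex.conj_conj]
    ring
  · rfl

theorem sqrtEnergy_re_le [Finite K] {F : K[X]} (hF : F ≠ 0) [Fintype (K[X] ⧸ Ideal.span {F})]
    (α : (K[X] ⧸ Ideal.span {F}) → ℂ) :
    (sqrtEnergy F α).re ≤ ∑ l, shiftWeight (fun x => ‖α x‖) l ^ 2 := by
  classical
  rw [← sum_energy_eq_sum_shiftWeight_sq, sqrtEnergy_eq_sum hF]
  refine (Complex.re_le_norm _).trans ?_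
  refine norm_sum_le_of_le _ fun x₁ _ => norm_sum_le_of_le _ fun x₂ _ =>
    norm_sum_le_of_le _ fun x₃ _ => norm_sum_le_of_le _ fun x₄ _ => ?_
  split_ifs
  · simp
  · simp

theorem finite_quotient_span [Finite K] {F : K[X]} (hF : F ≠ 0) :
    Finite (K[X] ⧸ Ideal.span {F}) := by
  refine Finite.of_surjective
    (fun p : polyDegLT K F.natDegree => Ideal.Quotient.mk (Ideal.span {F}) p.1) fun y => ?_
  obtain ⟨x, rfl⟩ := Ideal.Quotient.mk_surjective y
  refine ⟨⟨x % F, mem_polyDegLT.2 ?_⟩, ?_⟩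
  · rw [← degree_eq_natDegree hF]
    exact EuclideanDomain.mod_lt x hF
  · exact mk_mod F x

theorem sqrtEnergy_re_le_mul [Finite K] {F : K[X]} (hF : Irreducible F) (h2K : (2 : K) ≠ 0) {m : ℕ}
    (hm0 : 0 < m) (hm : m ≤ F.natDegree) (α : (K[X] ⧸ Ideal.span {F}) → ℂ)
    (hα : ∀ x : K[X], weightAt α x ≠ 0 → degMod F x < (m : WithBot ℕ)) :
    (sqrtEnergy F α).re ≤ l1Norm α ^ (4 / 3 : ℝ) * lInftyNorm α ^ (8 / 3 : ℝ) *
        ((Nat.card K : ℝ) ^ m *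
          (152 * (Nat.card K : ℝ) ^ 2 * m * (divisorBound (Nat.card K) (2 * m) : ℝ) ^ 2)) *
        ((Nat.card K : ℝ) ^ (7 * (m : ℝ) / 6 - (F.natDegree : ℝ) / 2) + 1) := by
  have hF0 := hF.ne_zero
  have := finite_quotient_span hF0
  have := Fintype.ofFinite (K[X] ⧸ Ideal.span {F})
  have : (Ideal.span {F}).IsPrime := (Ideal.span_singleton_prime hF0).2 hF.prime
  have hφ : ∀ p, Ideal.Quotient.mk (Ideal.span {F}) p = 0 ↔ F ∣ p := fun p => by
    rw [Ideal.Quotient.eq_zero_iff_mem, Ideal.mem_span_singleton]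
  have h2 : (2 : K[X] ⧸ Ideal.span {F}) ≠ 0 := by
    have h := (map_ne_zero ((Ideal.Quotient.mk (Ideal.span {F})).comp (C : K →+* K[X]))).2 h2K
    rwa [map_ofNat] at h
  have hl1 : l1Norm α = ∑ x, ‖α x‖ := finsum_eq_sum_of_fintype _
  rw [hl1]
  refine (sqrtEnergy_re_le hF0 α).trans (sum_shiftWeight_sq_le hF0 hφ hm0 hm h2K h2
    (fun x => norm_nonneg _) (fun x => le_ciSup (f := fun x => ‖α x‖)
      (Set.finite_range _).bddAbove x) fun y hy => ?_)
  obtain ⟨x, rfl⟩ := Ideal.Quotient.mk_surjective y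
  refine ⟨x % F, hα x (norm_ne_zero_iff.1 hy), mk_mod F x⟩

end Transfer

/-! ### The error exponent and the final bound -/

theorem isLittleO_log_energyConstant {q : ℕ} (hq : 0 < q) :
    (fun m : ℕ => Real.log (152 * (q : ℝ) ^ 2 * m * (divisorBound q (2 * m) : ℝ) ^ 2) /
      Real.log q) =o[atTop] (fun m : ℕ => (m : ℝ)) := by
  have hcast := tendsto_natCast_atTop_atTop (R := ℝ)
  have h1 : (fun _ : ℕ => Real.log (152 * (q : ℝ) ^ 2)) =o[atTop] (fun m : ℕ => (m : ℝ)) :=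
    isLittleO_const_left.2 (Or.inr (tendsto_norm_atTop_atTop.comp hcast))
  have h2 : (fun m : ℕ => Real.log m) =o[atTop] (fun m : ℕ => (m : ℝ)) :=
    Real.isLittleO_log_id_atTop.comp_tendsto hcast
  have h3 : (fun m : ℕ => Real.log (divisorBound q (2 * m))) =o[atTop]
      (fun m : ℕ => (m : ℝ)) := by
    have ht : Tendsto (fun m : ℕ => 2 * m) atTop atTop :=
      tendsto_id.const_mul_atTop' two_pos
    refine ((isLittleO_log_divisorBound hq).comp_tendsto ht).trans_isBigO ?_
    refine ((isBigO_refl (fun m : ℕ => (m : ℝ)) atTop).const_mul_left 2).congr_left fun m => ?_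
    simp
  have h4 := ((h1.add h2).add (h3.const_mul_left 2)).const_mul_left (Real.log q)⁻¹
  refine h4.congr' ?_ EventuallyEq.rfl
  filter_upwards [eventually_gt_atTop 0] with m hm
  have hD : (0 : ℝ) < divisorBound q (2 * m) := by
    exact_mod_cast one_le_divisorBound hq (2 * m)
  have hq0 : (0 : ℝ) < q := by exact_mod_cast hq
  have hm0 : (0 : ℝ) < m := by exact_mod_cast hm
  rw [Real.log_mul (x := 152 * (q : ℝ) ^ 2 * m) (by positivity) (by positivity),
    Real.log_mul (x := 152 * (q : ℝ) ^ 2) (by positivity) hm0.ne', Real.log_pow (divisorBound q (2 * m) : ℝ) 2]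
  push_cast
  ring

theorem theorem2p5 (q : ℕ) (hq : Odd q) :
    ∃ g : ℕ → ℝ, g =o[atTop] (fun m : ℕ => (m : ℝ)) ∧
      ∀ (K : Type u) [Field K] [Fintype K], Fintype.card K = q →
        ∀ (F : K[X]) (r m : ℕ), Irreducible F → F.natDegree = r → 0 < m → m ≤ r →
          ∀ α : (K[X] ⧸ Ideal.span {F}) → ℂ,
            (∀ x : K[X], weightAt α x ≠ 0 → degMod F x < (m : WithBot ℕ)) →
              (sqrtEnergy F α).im = 0 ∧
                (sqrtEnergy F α).re ≤
                  l1Norm α ^ (4 / 3 : ℝ) * lInftyNorm α ^ (8 / 3 : ℝ) *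
                    (q : ℝ) ^ ((m : ℝ) + g m) *
                      ((q : ℝ) ^ (7 * (m : ℝ) / 6 - (r : ℝ) / 2) + 1) := by
  -- g(m) is the base-q logarithm of the accumulated loss, so q^{g(m)} reproduces it exactly.
  refine ⟨_, isLittleO_log_energyConstant hq.pos, ?_⟩
  intro K _ _ hK F r m hF hr hm0 hmr α hα
  refine ⟨sqrtEnergy_im F α, ?_⟩
  have h2K : (2 : K) ≠ 0 := by
    intro h
    have h1 := CharP.ringChar_of_prime_eq_zero Nat.prime_two (by exact_mod_cast h : ((2 : ℕ) : K) = 0)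
    have h2 := FiniteField.even_card_iff_char_two.1 h1
    rw [hK] at h2
    exact (Nat.not_even_iff_odd.2 hq) (Nat.even_iff.2 h2)
  have hq1 : 1 < q := hK ▸ Fintype.one_lt_card
  have hq0 : (0 : ℝ) < q := by exact_mod_cast hq.pos
  have hlog : Real.log q ≠ 0 := (Real.log_pos (by exact_mod_cast hq1)).ne'
  have hD : (0 : ℝ) < divisorBound q (2 * m) := by
    exact_mod_cast one_le_divisorBound hq.pos (2 * m)
  have hm0' : (0 : ℝ) < m := by exact_mod_cast hm0
  subst hr
  have key := sqrtEnergy_re_le_mul hF h2K hm0 hmr α hα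
  rw [Nat.card_eq_fintype_card, hK] at key
  refine key.trans_eq ?_
  congr 2
  rw [Real.rpow_add hq0, Real.rpow_natCast]
  congr 1
  rw [Real.rpow_def_of_pos hq0, mul_div_cancel₀ _ hlog, Real.exp_log (by positivity)]
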